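/- Let $k$ be a field and let $R=\bigoplus_{i\ge 0}R_i$ be a standard graded associative $k$-algebra, that is, $R_0=k$, every $R_i$ is finite-dimensional, and $R$ is generated as a $k$-algebra by $R_1$. Let $x_1,\dots,x_n$ be a minimal system of generators of $R$ consisting of linear forms, i.e. a $k$-basis of $R_1$, and let $I$ be the ideal of relations, i.e. the kernel of the homomorphism $k\langle X_1,\dots,X_n\rangle\to R$, $X_i\mapsto x_i$. Theorem. Suppose that $R$ is PBW with respect to the order $x_1<\dots<x_n$, i.e. that $I$ has a (noncommutative) Gröbner basis consisting of quadratic forms with respect to the degree-lexicographical order derived from $X_1<\dots<X_n$ (words are compared first by length, then lexicographically from left to right). Then $(x_1,\dots,x_n)$ is a Koszul flag. That is, $x_1R+\dots+x_nR=\bigoplus_{i\ge1}R_i$, and for every $0<m\le n$ the right ideal $I_m=x_1R+\dots+x_mR$ is a Koszul module: it is a graded right $R$-module which has a linear free resolution, i.e., for some $d$, an exact complex of graded right $R$-modules and degree-preserving maps $$\cdots\to F_2\to F_1\to F_0\to I_m\to 0$$ in which each $F_i$ is a free module of finite rank with all its generators in degree $d+i$. -/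

import Mathlib

/-! ### Graded algebras and graded right modules -/

/-- A graded `k`-algebra `R = R_0 ⊕ R_1 ⊕ …` is *standard* if it is connected (`R_0 = k`), all its
components are finite-dimensional, and it is generated as a `k`-algebra by `R_1`. -/
structure IsStandardAlgebra {k R : Type*} [Field k] [Ring R] [Algebra k R]
    (𝒜 : ℕ → Submodule k R) [GradedAlgebra 𝒜] : Prop where
  algebraMap_injective : Function.Injective (algebraMap k R)
  zero_component : ∀ r : R, r ∈ 𝒜 0 ↔ ∃ c : k, algebraMap k R c = r
  finite_component : ∀ i, FiniteDimensional k (𝒜 i)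
  generated : Algebra.adjoin k (𝒜 1 : Set R) = ⊤

/-- `ℳ` is a grading of the right `R`-module `M` (a module over `Rᵐᵒᵖ`) by nonnegative integers,
compatible with the grading of `R`, with finite-dimensional components. -/
structure IsGradedRightModule {k R M : Type*} [Field k] [Ring R] [Algebra k R]
    (𝒜 : ℕ → Submodule k R) [AddCommGroup M] [Module k M] [Module Rᵐᵒᵖ M]
    [IsScalarTower k Rᵐᵒᵖ M] (ℳ : ℕ → Submodule k M) : Prop where
  internal : DirectSum.IsInternal ℳ
  smul_mem : ∀ i j : ℕ, ∀ m ∈ ℳ i, ∀ r ∈ 𝒜 j, MulOpposite.op r • m ∈ ℳ (i + j)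
  finite_component : ∀ i, FiniteDimensional k (ℳ i)

/-- The component of degree `j` of the shifted algebra `R(-s)`: it is `R_{j-s}` for `s ≤ j`, and
zero for `j < s`. -/
def shiftedComponent {k R : Type*} [Field k] [Ring R] [Algebra k R]
    (𝒜 : ℕ → Submodule k R) (s j : ℕ) : Submodule k R :=
  if s ≤ j then 𝒜 (j - s) else ⊥

/-- The component of degree `j` of the graded free right module `R(-s)^b`, whose `b` free
generators have degree `s`. -/
def freeComponent {k R : Type*} [Field k] [Ring R] [Algebra k R]
    (𝒜 : ℕ → Submodule k R) (b s j : ℕ) : Submodule k (Fin b → R) :=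
  Submodule.pi Set.univ fun _ => shiftedComponent 𝒜 s j

/-- A *linear free resolution* of degree `d` of a graded right module `M`: an exact complex
`… → F_2 → F_1 → F_0 → M → 0` of graded right modules and degree-preserving `R`-linear maps, with
`F_i = R(-(d+i))^(b_i)` free with all its generators in degree `d + i`. (All graded objects
being finite-dimensional in every degree, `F_i` has finite rank.) -/
structure LinearFreeResolution {k R M : Type*} [Field k] [Ring R] [Algebra k R]
    (𝒜 : ℕ → Submodule k R) [AddCommGroup M] [Module k M] [Module Rᵐᵒᵖ M]
    [IsScalarTower k Rᵐᵒᵖ M] (ℳ : ℕ → Submodule k M) (d : ℕ) where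
  rank : ℕ → ℕ
  aug : (Fin (rank 0) → R) →ₗ[Rᵐᵒᵖ] M
  diff : ∀ i, (Fin (rank (i + 1)) → R) →ₗ[Rᵐᵒᵖ] (Fin (rank i) → R)
  aug_graded : ∀ j, ∀ v ∈ freeComponent 𝒜 (rank 0) d j, aug v ∈ ℳ j
  diff_graded : ∀ i j, ∀ v ∈ freeComponent 𝒜 (rank (i + 1)) (d + (i + 1)) j,
    diff i v ∈ freeComponent 𝒜 (rank i) (d + i) j
  aug_surjective : Function.Surjective aug
  exact_zero : Function.Exact (diff 0) aug
  exact_succ : ∀ i, Function.Exact (diff (i + 1)) (diff i)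

/-- A graded right module is *Koszul* if it has a linear free resolution (of some degree `d`). -/
def IsKoszulModule {k R M : Type*} [Field k] [Ring R] [Algebra k R]
    (𝒜 : ℕ → Submodule k R) [AddCommGroup M] [Module k M] [Module Rᵐᵒᵖ M]
    [IsScalarTower k Rᵐᵒᵖ M] (ℳ : ℕ → Submodule k M) : Prop :=
  IsGradedRightModule 𝒜 ℳ ∧ ∃ d : ℕ, Nonempty (LinearFreeResolution 𝒜 ℳ d)

/-! ### Koszul flags -/

/-- The right ideal `x_1 R + ⋯ + x_m R`, where the family `x_1, …, x_n` is indexed by `Fin n`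
(so `x_i` is the value at `i - 1`). -/
def flagIdeal {R : Type*} [Ring R] {n : ℕ} (x : Fin n → R) (m : ℕ) : Submodule Rᵐᵒᵖ R :=
  Submodule.span Rᵐᵒᵖ (x '' {i | (i : ℕ) < m})

/-- The component of degree `j` of a right ideal `J` of `R`: the elements of `J` that lie
in `R_j`. -/
def rightIdealComponent {k R : Type*} [Field k] [Ring R] [Algebra k R]
    (𝒜 : ℕ → Submodule k R) (J : Submodule Rᵐᵒᵖ R) (j : ℕ) : Submodule k J :=
  (𝒜 j).comap (J.subtype.restrictScalars k)

/-- `(x_1, …, x_n)` is a *linear flag*: the `x_i` are of degree one, and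
`x_1 R + ⋯ + x_n R` is the maximal homogeneous ideal `R_1 ⊕ R_2 ⊕ …`. -/
structure IsLinearFlag {k R : Type*} [Field k] [Ring R] [Algebra k R]
    (𝒜 : ℕ → Submodule k R) [GradedAlgebra 𝒜] {n : ℕ} (x : Fin n → R) : Prop where
  linear : ∀ i, x i ∈ 𝒜 1
  top_eq : (flagIdeal x n : Set R) = (HomogeneousIdeal.irrelevant 𝒜 : Set R)

/-- A *Koszul flag* is a linear flag all of whose ideals `x_1 R + ⋯ + x_m R`, `0 < m ≤ n`, are
Koszul modules. -/
structure IsKoszulFlag {k R : Type*} [Field k] [Ring R] [Algebra k R]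
    (𝒜 : ℕ → Submodule k R) [GradedAlgebra 𝒜] {n : ℕ} (x : Fin n → R) : Prop where
  isLinearFlag : IsLinearFlag 𝒜 x
  koszul : ∀ m : ℕ, 0 < m → m ≤ n → IsKoszulModule 𝒜 (rightIdealComponent 𝒜 (flagIdeal x m))

/-! ### Noncommutative Gröbner bases and PBW algebras -/

/-- The free associative algebra `k⟨X_1, …, X_n⟩`, with the words as `k`-basis. -/
abbrev WordAlgebra (k : Type*) [Field k] (n : ℕ) : Type _ := MonoidAlgebra k (FreeMonoid (Fin n))

/-- The degree-lexicographical order on words derived from `X_1 < ⋯ < X_n`: words are compared by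
length, and words of equal length lexicographically from left to right. -/
def DegLexLT {n : ℕ} (u v : FreeMonoid (Fin n)) : Prop :=
  List.Shortlex (· < ·) u.toList v.toList

/-- `w` is the leading monomial of `f`: the greatest word that occurs in `f`. -/
def IsLeadingMonomial {k : Type*} [Field k] {n : ℕ} (f : WordAlgebra k n)
    (w : FreeMonoid (Fin n)) : Prop :=
  w ∈ f.coeff.support ∧ ∀ u ∈ f.coeff.support, u ≠ w → DegLexLT u w

/-- `G` is a Gröbner basis of the two-sided ideal `I` of the free algebra with respect to the
degree-lexicographical order: `G` consists of elements of `I`, and the leading monomial of each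
nonzero element of `I` contains the leading monomial of some element of `G` as a subword. -/
def IsGroebnerBasis {k : Type*} [Field k] {n : ℕ} (I : TwoSidedIdeal (WordAlgebra k n))
    (G : Set (WordAlgebra k n)) : Prop :=
  (∀ g ∈ G, g ∈ I) ∧
    ∀ f ∈ I, ∀ w, IsLeadingMonomial f w →
      ∃ g ∈ G, ∃ u, IsLeadingMonomial g u ∧ u.toList <:+: w.toList

/-- `f` is a linear combination of words of length two. -/
def IsQuadraticForm {k : Type*} [Field k] {n : ℕ} (f : WordAlgebra k n) : Prop :=
  ∀ w ∈ f.coeff.support, w.toList.length = 2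

/-- The two-sided ideal of relations between `x_1, …, x_n`: the kernel of the algebra
homomorphism from the free algebra to `R` that sends `X_i` to `x_i`. -/
noncomputable def relationIdeal (k : Type*) {R : Type*} [Field k] [Ring R] [Algebra k R] {n : ℕ}
    (x : Fin n → R) : TwoSidedIdeal (WordAlgebra k n) :=
  TwoSidedIdeal.ker (MonoidAlgebra.lift k R (FreeMonoid (Fin n)) (FreeMonoid.lift x))

/-- `x_1, …, x_n` is a minimal system of generators of the space `R_1` of linear forms (hence, for
standard `R`, of the algebra `R`), that is, a basis of `R_1`. -/
structure IsMinimalLinearGenerators {k R : Type*} [Field k] [Ring R] [Algebra k R]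
    (𝒜 : ℕ → Submodule k R) {n : ℕ} (x : Fin n → R) : Prop where
  linearIndependent : LinearIndependent k x
  span_eq : Submodule.span k (Set.range x) = 𝒜 1

/-- `R` is PBW with respect to the order `x_1 < ⋯ < x_n` on its generators: the ideal
of relations has a Gröbner basis that consists of quadratic forms. -/
def IsPBW (k : Type*) {R : Type*} [Field k] [Ring R] [Algebra k R] {n : ℕ} (x : Fin n → R) :
    Prop :=
  ∃ G : Set (WordAlgebra k n), IsGroebnerBasis (relationIdeal k x) G ∧ ∀ g ∈ G, IsQuadraticForm g

/-!
The proof is Anick's construction of a resolution, carried out one syzygy module at a time.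

Call a word in the generators *reducible* if its value in `R` is a linear combination of the values
of smaller words of the same length. The existence of a quadratic Gröbner basis enters only through
one consequence (`IsPBW.isReducibleWord_cons_cons`): if `w = b b' u` is reducible but `b' u` is
not, then already `b b'` is reducible. Together with the irreducibility of the letters, this tells
which words `b w` with `w` irreducible are reducible.

Terms `e_c ⬝ x_w` of a free right module `R^r` are ordered by the index `c` first and then by the
word `w`. Suppose that the leading terms of a homogeneous submodule `K` of `R^r` are the
`e_c ⬝ x_b x_w`, `b w` irreducible, with `(c, b)` in a given set `S` (`HasLeadingTerms`). Choose
elements of `K` with the leading terms `e_c ⬝ x_b`, `(c, b) ∈ S`; they are linear forms. Division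
with remainder shows that they generate `K`
(`IsLeadingFamily.exists_freeModuleMap_eq_of_mem_span`). Let `S` index the generators of a new free
module, ordered lexicographically. The map onto `K` sends the term `e_(c,b) ⬝ x_w`, with `w`
irreducible, to an element of leading term `e_c ⬝ x_b x_w`, unless `b w` is reducible; so the
leading terms of its kernel are the `e_(c,b) ⬝ x_w` with `b w` reducible, that is, those for which
`w` starts with a letter `b'` such that `b b'` is reducible
(`IsLeadingFamily.hasLeadingTerms_ker`). The kernel is thus a submodule of the same kind, and
iteration yields a linear free resolution of `K` (`SyzygyStage.resolution`).

The ideal `x_1 R + ⋯ + x_m R` is such a submodule of `R^1`, with `S` given by the letters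
`1, …, m` (`hasLeadingTerms_flagIdeal`): reducing a word never increases its first letter.
-/

/-! ### Words in the generators and reducible words -/

/-- The product `x_{w_1} ⋯ x_{w_j}` of the family `x` along the word `w`. -/
def wordProd {R : Type*} [Ring R] {n : ℕ} (x : Fin n → R) (w : List (Fin n)) : R :=
  (w.map x).prod

/-- The word `w` is *reducible* if its value in `R` is a linear combination of the values of
smaller words of the same length. The irreducible words are the normal words of Gröbner basis
theory, described here without reference to a Gröbner basis. -/
def IsReducibleWord (k : Type*) {R : Type*} [Field k] [Ring R] [Algebra k R] {n : ℕ}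
    (x : Fin n → R) (w : List (Fin n)) : Prop :=
  wordProd x w ∈ Submodule.span k (wordProd x '' {u | u.length = w.length ∧ u < w})

section Words

variable {k R : Type*} [Field k] [Ring R] [Algebra k R] {n : ℕ} {x : Fin n → R}

@[simp]
theorem wordProd_nil : wordProd x [] = 1 := rfl

@[simp]
theorem wordProd_cons (b : Fin n) (w : List (Fin n)) :
    wordProd x (b :: w) = x b * wordProd x w := by
  simp [wordProd]

theorem wordProd_append (u v : List (Fin n)) :
    wordProd x (u ++ v) = wordProd x u * wordProd x v := by
  simp [wordProd]

theorem lift_eq_sum_smul_wordProd (f : WordAlgebra k n) :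
    MonoidAlgebra.lift k R (FreeMonoid (Fin n)) (FreeMonoid.lift x) f =
      f.coeff.sum fun u a => a • wordProd x u.toList := by
  simp only [MonoidAlgebra.lift_apply, FreeMonoid.lift_apply, wordProd]

theorem List.append_lt_append_of_length_eq {α : Type*} [LinearOrder α] {u v : List α}
    (hlen : u.length = v.length) (h : u < v) (q : List α) : u ++ q < v ++ q := by
  induction u generalizing v with
  | nil =>
    cases v with
    | nil => exact absurd h (lt_irrefl _)
    | cons b v => simp at hlen
  | cons a u ih =>
    cases v with
    | nil => simp at hlen
    | cons b v =>
      rw [List.cons_lt_cons_iff] at h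
      rw [List.cons_append, List.cons_append, List.cons_lt_cons_iff]
      exact h.imp_right fun h => ⟨h.1, ih (by simpa using hlen) h.2⟩

theorem IsReducibleWord.append_append {u : List (Fin n)} (h : IsReducibleWord k x u)
    (p q : List (Fin n)) : IsReducibleWord k x (p ++ u ++ q) := by
  unfold IsReducibleWord at h ⊢
  have key := Submodule.mem_map_of_mem
    (f := (LinearMap.mulLeft k (wordProd x p)).comp (LinearMap.mulRight k (wordProd x q))) h
  rw [Submodule.map_span] at key
  simp only [LinearMap.comp_apply, LinearMap.mulRight_apply, LinearMap.mulLeft_apply] at key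
  rw [wordProd_append, wordProd_append, mul_assoc]
  refine Submodule.span_mono ?_ key
  rintro _ ⟨_, ⟨v, ⟨hlen, hlt⟩, rfl⟩, rfl⟩
  refine ⟨p ++ v ++ q, ⟨by simp [hlen], ?_⟩, ?_⟩
  · rw [List.append_assoc, List.append_assoc]
    exact List.Lex.append_left _ (List.append_lt_append_of_length_eq hlen hlt q) p
  · simp [wordProd_append]

theorem not_isReducibleWord_singleton (hx : LinearIndependent k x) (b : Fin n) :
    ¬ IsReducibleWord k x [b] := by
  intro h
  refine hx.notMem_span_image (s := {a | a < b}) (x := b) (by simp) ?_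
  have hb : wordProd x [b] = x b := by simp
  rw [IsReducibleWord, hb] at h
  refine Submodule.span_mono ?_ h
  rintro _ ⟨v, ⟨hlen, hlt⟩, rfl⟩
  obtain ⟨a, rfl⟩ := List.length_eq_one_iff.1 hlen
  refine ⟨a, ?_, by simp⟩
  rw [List.cons_lt_cons_iff] at hlt
  exact hlt.resolve_right fun h => absurd h.2 (lt_irrefl _)

/-- The leading monomial of a homogeneous relation is a reducible word. -/
theorem IsLeadingMonomial.isReducibleWord {g : WordAlgebra k n} {v : FreeMonoid (Fin n)}
    (hv : IsLeadingMonomial g v) (hg : g ∈ relationIdeal k x)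
    (hlen : ∀ u ∈ g.coeff.support, u.toList.length = v.toList.length) :
    IsReducibleWord k x v.toList := by
  classical
  rw [relationIdeal, TwoSidedIdeal.mem_ker, lift_eq_sum_smul_wordProd, Finsupp.sum,
    ← Finset.add_sum_erase _ _ hv.1] at hg
  have hne : g.coeff v ≠ 0 := Finsupp.mem_support_iff.1 hv.1
  unfold IsReducibleWord
  rw [← Submodule.smul_mem_iff _ hne, eq_neg_of_add_eq_zero_left hg]
  refine neg_mem (sum_mem fun u hu => Submodule.smul_mem _ _ (Submodule.subset_span ?_))
  obtain ⟨huv, hu⟩ := Finset.mem_erase.1 hu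
  refine ⟨u.toList, ⟨hlen u hu, ?_⟩, rfl⟩
  exact (List.shortlex_iff_lex (hlen u hu)).1 (hv.2 u hu huv)

/-- A reducible word is the leading monomial of a relation. -/
theorem IsReducibleWord.exists_isLeadingMonomial {w : List (Fin n)}
    (h : IsReducibleWord k x w) :
    ∃ f ∈ relationIdeal k x, IsLeadingMonomial f (FreeMonoid.ofList w) := by
  classical
  obtain ⟨l, hl, hlw⟩ := (Finsupp.mem_span_image_iff_linearCombination k).1 h
  rw [Finsupp.mem_supported] at hl
  let l' : FreeMonoid (Fin n) →₀ k := l.equivMapDomain FreeMonoid.ofList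
  have hl' : ∀ u, l' u = l u.toList := fun u => by
    rw [Finsupp.equivMapDomain_apply]; rfl
  have hlw0 : l w = 0 := by
    by_contra h0
    exact absurd (hl (Finsupp.mem_support_iff.2 h0)).2 (lt_irrefl _)
  let f : WordAlgebra k n := MonoidAlgebra.single (FreeMonoid.ofList w) 1 - ⟨l'⟩
  have hf : ∀ u, f.coeff u = Finsupp.single (FreeMonoid.ofList w) (1 : k) u - l u.toList :=
    fun u => by
      rw [← hl']; rfl
  refine ⟨f, ?_, ?_, ?_⟩
  · rw [relationIdeal, TwoSidedIdeal.mem_ker, map_sub, MonoidAlgebra.lift_single, one_smul,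
      sub_eq_zero, lift_eq_sum_smul_wordProd, FreeMonoid.lift_apply]
    change wordProd x w = l'.sum _
    rw [← hlw, Finsupp.linearCombination_apply, Finsupp.sum_equivMapDomain]
    rfl
  · rw [Finsupp.mem_support_iff, hf]
    simp [hlw0]
  · intro u hu huw
    rw [Finsupp.mem_support_iff, hf, Finsupp.single_eq_of_ne huw, zero_sub, neg_ne_zero] at hu
    have := hl (Finsupp.mem_support_iff.2 hu)
    exact List.Shortlex.of_lex this.1 this.2

/-- The form in which the PBW property is used: a reducible word all of whose proper suffixes are
irreducible starts with a reducible word of length two. -/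
theorem IsPBW.isReducibleWord_cons_cons (hx : IsPBW k x) {a b : Fin n} {w : List (Fin n)}
    (h : IsReducibleWord k x (a :: b :: w)) :
    IsReducibleWord k x [a, b] ∨ IsReducibleWord k x (b :: w) := by
  obtain ⟨G, ⟨hGI, hG⟩, hquad⟩ := hx
  obtain ⟨f, hf, hfw⟩ := h.exists_isLeadingMonomial
  obtain ⟨g, hg, u, hgu, hu⟩ := hG f hf _ hfw
  have hu2 := hquad g hg u hgu.1
  have hred : IsReducibleWord k x u.toList :=
    hgu.isReducibleWord (hGI g hg) fun v hv => by rw [hquad g hg v hv, hu2]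
  rw [FreeMonoid.toList_ofList, List.infix_cons_iff] at hu
  rcases hu with hu | ⟨p, q, hu⟩
  · obtain ⟨c, d, hcd⟩ := List.length_eq_two.1 hu2
    rw [hcd] at hu hred
    simp only [List.cons_prefix_cons, List.nil_prefix, and_true] at hu
    rw [hu.1, hu.2] at hred
    exact Or.inl hred
  · exact Or.inr (hu ▸ hred.append_append p q)

end Words

/-! ### Leading terms in free right modules -/

/-- The term `e_c ⬝ x_w` of the free right module `R^r`, for a pair `t = (c, w)` of an index and
a word. The pairs are ordered lexicographically. -/
def termVector {R : Type*} [Ring R] {n r : ℕ} (x : Fin n → R) (t : Fin r ×ₗ List (Fin n)) :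
    Fin r → R :=
  Pi.single (ofLex t).1 (wordProd x (ofLex t).2)

/-- The span of the terms of the same degree as the term `t` that are smaller than `t`. -/
def lowerSpan (k : Type*) {R : Type*} [Field k] [Ring R] [Algebra k R] {n r : ℕ} (x : Fin n → R)
    (t : Fin r ×ₗ List (Fin n)) : Submodule k (Fin r → R) :=
  Submodule.span k (termVector x '' {s | (ofLex s).2.length = (ofLex t).2.length ∧ s < t})

/-- For `σ s = (c, b)`, the term `e_c ⬝ x_b x_w` of `R^r` attached to the term `e_s ⬝ x_w`
of `R^r'`. -/
def prependTerm {n r r' : ℕ} (σ : Fin r' ↪o Fin r ×ₗ Fin n) (t : Fin r' ×ₗ List (Fin n)) :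
    Fin r ×ₗ List (Fin n) :=
  toLex ((ofLex (σ (ofLex t).1)).1, (ofLex (σ (ofLex t).1)).2 :: (ofLex t).2)

/-- The leading terms of the submodule `K` of `R^r` are the terms `e_c ⬝ x_b x_w` with `(c, b)` in
the range of `σ` and `b w` irreducible. Here a term with an irreducible word is a leading term
of `K` if, modulo smaller terms of the same degree, it lies in `K`. As `σ` is strictly
monotone, the free module on its domain inherits the order on terms used for syzygies. -/
def HasLeadingTerms (k : Type*) {R : Type*} [Field k] [Ring R] [Algebra k R] {n r r' : ℕ}
    (x : Fin n → R) (K : Submodule Rᵐᵒᵖ (Fin r → R)) (σ : Fin r' ↪o Fin r ×ₗ Fin n) : Prop :=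
  ∀ t : Fin r ×ₗ List (Fin n), ¬ IsReducibleWord k x (ofLex t).2 →
    (termVector x t ∈ K.restrictScalars k ⊔ lowerSpan k x t ↔ t ∈ Set.range (prependTerm σ))

/-- The homomorphism of right modules `R^r' → R^r` that sends the generator `e_s` to `g s`. -/
def freeModuleMap {R : Type*} [Ring R] {r r' : ℕ} (g : Fin r' → Fin r → R) :
    (Fin r' → R) →ₗ[Rᵐᵒᵖ] (Fin r → R) where
  toFun v c := ∑ s, g s c * v s
  map_add' u v := by
    ext c
    simp [mul_add, Finset.sum_add_distrib]
  map_smul' a v := by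
    ext c
    simp [Finset.sum_mul, mul_assoc]

section LeadingTerms

variable {k R : Type*} [Field k] [Ring R] [Algebra k R] {n r r' : ℕ} {x : Fin n → R}

theorem freeModuleMap_apply (g : Fin r' → Fin r → R) (v : Fin r' → R) (c : Fin r) :
    freeModuleMap g v c = ∑ s, g s c * v s := rfl

theorem freeModuleMap_apply_eq_sum (g : Fin r' → Fin r → R) (v : Fin r' → R) :
    freeModuleMap g v = ∑ s, MulOpposite.op (v s) • g s := by
  ext c
  simp [freeModuleMap_apply]

theorem freeModuleMap_termVector (g : Fin r' → Fin r → R) (t : Fin r' ×ₗ List (Fin n)) :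
    freeModuleMap g (termVector x t) =
      fun c => g (ofLex t).1 c * wordProd x (ofLex t).2 := by
  ext c
  rw [freeModuleMap_apply, Finset.sum_eq_single (ofLex t).1]
  · simp [termVector]
  · intro s _ hs
    simp [termVector, Pi.single_eq_of_ne hs]
  · simp

theorem termVector_mem_lowerSpan_iff (t : Fin r ×ₗ List (Fin n)) :
    termVector x t ∈ lowerSpan k x t ↔ IsReducibleWord k x (ofLex t).2 := by
  constructor
  · intro h
    have key := Submodule.mem_map_of_mem
      (f := (LinearMap.proj (ofLex t).1 : (Fin r → R) →ₗ[k] R)) h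
    rw [lowerSpan, Submodule.map_span] at key
    have ht : (LinearMap.proj (ofLex t).1 : (Fin r → R) →ₗ[k] R) (termVector x t) =
        wordProd x (ofLex t).2 := by simp [termVector]
    rw [ht] at key
    refine Submodule.span_le.2 ?_ key
    rintro _ ⟨_, ⟨s, ⟨hlen, hlt⟩, rfl⟩, rfl⟩
    by_cases hc : (ofLex s).1 = (ofLex t).1
    · refine Submodule.subset_span ⟨(ofLex s).2, ⟨hlen, ?_⟩, ?_⟩
      · exact ((Prod.Lex.lt_iff.1 hlt).resolve_left fun h => h.ne hc).2
      · simp [termVector, ← hc]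
    · have : (LinearMap.proj (ofLex t).1 : (Fin r → R) →ₗ[k] R) (termVector x s) = 0 := by
        simp [termVector, Pi.single_eq_of_ne (Ne.symm hc)]
      rw [this]
      exact zero_mem _
  · intro h
    have key := Submodule.mem_map_of_mem
      (f := LinearMap.single k (fun _ : Fin r => R) (ofLex t).1) h
    rw [Submodule.map_span] at key
    refine Submodule.span_mono ?_ key
    rintro _ ⟨_, ⟨u, ⟨hlen, hlt⟩, rfl⟩, rfl⟩
    exact ⟨toLex ((ofLex t).1, u), ⟨hlen, Prod.Lex.lt_iff.2 (Or.inr ⟨rfl, hlt⟩)⟩, rfl⟩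

/-- Prepending is strictly monotone because both orders are lexicographic in `c`, `b` and the
word. -/
theorem prependTerm_lt_prependTerm_iff {σ : Fin r' ↪o Fin r ×ₗ Fin n}
    {s t : Fin r' ×ₗ List (Fin n)} : prependTerm σ s < prependTerm σ t ↔ s < t := by
  rw [Prod.Lex.lt_iff, Prod.Lex.lt_iff, ← σ.lt_iff_lt, ← σ.injective.eq_iff, Prod.Lex.lt_iff,
    ← ofLex.injective.eq_iff, Prod.ext_iff]
  simp only [prependTerm, ofLex_toLex, List.cons_lt_cons_iff]
  tauto

theorem length_prependTerm (σ : Fin r' ↪o Fin r ×ₗ Fin n) (t : Fin r' ×ₗ List (Fin n)) :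
    (ofLex (prependTerm σ t)).2.length = (ofLex t).2.length + 1 := rfl

theorem finite_setOf_length_eq_and_lt (t : Fin r ×ₗ List (Fin n)) :
    {s : Fin r ×ₗ List (Fin n) | (ofLex s).2.length = (ofLex t).2.length ∧ s < t}.Finite := by
  refine Set.Finite.subset (((Set.finite_univ (α := Fin r)).prod
    (List.finite_length_eq (Fin n) (ofLex t).2.length)).preimage ofLex.injective.injOn) ?_
  intro s hs
  simpa using hs.1

/-- The family `g` consists of elements of `K`, and `g s` has the leading term `e_c ⬝ x_b` with
coefficient one, where `σ s = (c, b)`. -/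
structure IsLeadingFamily (k : Type*) {R : Type*} [Field k] [Ring R] [Algebra k R] {n r r' : ℕ}
    (x : Fin n → R) (K : Submodule Rᵐᵒᵖ (Fin r → R)) (σ : Fin r' ↪o Fin r ×ₗ Fin n)
    (g : Fin r' → Fin r → R) : Prop where
  mem : ∀ s, g s ∈ K
  sub_mem_lowerSpan : ∀ s, g s - termVector x (prependTerm σ (toLex (s, []))) ∈
    lowerSpan k x (prependTerm σ (toLex (s, [])))

variable {K : Submodule Rᵐᵒᵖ (Fin r → R)} {σ : Fin r' ↪o Fin r ×ₗ Fin n} {g : Fin r' → Fin r → R}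

theorem IsLeadingFamily.freeModuleMap_mem (hg : IsLeadingFamily k x K σ g) (v : Fin r' → R) :
    freeModuleMap g v ∈ K := by
  rw [freeModuleMap_apply_eq_sum]
  exact sum_mem fun s _ => K.smul_mem _ (hg.mem s)

/-- The image of the term `e_s ⬝ x_w` has the leading term `e_c ⬝ x_b x_w`, or smaller if the word
`b w` is reducible. -/
theorem IsLeadingFamily.freeModuleMap_termVector_sub_mem (hg : IsLeadingFamily k x K σ g)
    (t : Fin r' ×ₗ List (Fin n)) :
    freeModuleMap g (termVector x t) - termVector x (prependTerm σ t) ∈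
      lowerSpan k x (prependTerm σ t) := by
  have key := Submodule.mem_map_of_mem
    (f := LinearMap.compLeft (LinearMap.mulRight k (wordProd x (ofLex t).2)) (Fin r))
    (hg.sub_mem_lowerSpan (ofLex t).1)
  rw [lowerSpan, Submodule.map_span] at key
  have hmul : ∀ c (a : R), LinearMap.compLeft (LinearMap.mulRight k (wordProd x (ofLex t).2))
      (Fin r) (Pi.single c a) = Pi.single c (a * wordProd x (ofLex t).2) := by
    intro c a
    ext d
    by_cases h : d = c
    · subst h; simp
    · simp [Pi.single_eq_of_ne h]
  have heq : freeModuleMap g (termVector x t) - termVector x (prependTerm σ t) =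
      LinearMap.compLeft (LinearMap.mulRight k (wordProd x (ofLex t).2)) (Fin r)
        (g (ofLex t).1 - termVector x (prependTerm σ (toLex ((ofLex t).1, [])))) := by
    rw [map_sub, freeModuleMap_termVector, termVector, termVector, hmul]
    simp only [prependTerm, ofLex_toLex, wordProd_cons, wordProd_nil, mul_one]
    rfl
  rw [heq]
  refine Submodule.span_mono ?_ key
  rintro _ ⟨_, ⟨s, ⟨hlen, hlt⟩, rfl⟩, rfl⟩
  obtain ⟨⟨c, u⟩, rfl⟩ := toLex.surjective s
  obtain ⟨b, rfl⟩ := List.length_eq_one_iff.1 (hlen.trans (by rw [length_prependTerm]; rfl))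
  refine ⟨toLex (c, b :: (ofLex t).2), ⟨rfl, ?_⟩, ?_⟩
  · rw [Prod.Lex.lt_iff] at hlt ⊢
    simp only [prependTerm, ofLex_toLex, List.cons_lt_cons_iff] at hlt ⊢
    have := lt_irrefl ([] : List (Fin n))
    tauto
  · rw [termVector, termVector, hmul]
    simp

theorem IsLeadingFamily.freeModuleMap_mem_lowerSpan (hg : IsLeadingFamily k x K σ g)
    {t : Fin r' ×ₗ List (Fin n)} {y : Fin r' → R} (hy : y ∈ lowerSpan k x t) :
    freeModuleMap g y ∈ lowerSpan k x (prependTerm σ t) := by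
  have key := Submodule.mem_map_of_mem (f := (freeModuleMap g).restrictScalars k) hy
  rw [lowerSpan, Submodule.map_span] at key
  refine Submodule.span_le.2 ?_ key
  rintro _ ⟨_, ⟨s, ⟨hlen, hlt⟩, rfl⟩, rfl⟩
  have hlt' := prependTerm_lt_prependTerm_iff (σ := σ) |>.2 hlt
  have hlen' : (ofLex (prependTerm σ s)).2.length = (ofLex (prependTerm σ t)).2.length := by
    rw [length_prependTerm, length_prependTerm, hlen]
  have hmono : lowerSpan k x (prependTerm σ s) ≤ lowerSpan k x (prependTerm σ t) :=
    Submodule.span_mono (Set.image_mono fun v hv => ⟨hv.1.trans hlen', hv.2.trans hlt'⟩)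
  have hs : termVector x (prependTerm σ s) ∈ lowerSpan k x (prependTerm σ t) :=
    Submodule.subset_span (Set.mem_image_of_mem _ ⟨hlen', hlt'⟩)
  have h := add_mem (hmono (hg.freeModuleMap_termVector_sub_mem s)) hs
  rw [sub_add_cancel] at h
  exact h

/-- Division with zero remainder: an element of `K` in the span of a lower set `D` of terms lifts
to a combination of terms whose images have leading terms in `D`. -/
theorem IsLeadingFamily.exists_freeModuleMap_eq_of_mem_span (hg : IsLeadingFamily k x K σ g)
    (hK : HasLeadingTerms k x K σ) (j : ℕ) (D : Finset (Fin r ×ₗ List (Fin n)))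
    (hlen : ∀ t ∈ D, (ofLex t).2.length = j)
    (hlower : ∀ t ∈ D, ∀ s, (ofLex s).2.length = j → s < t → s ∈ D)
    {v : Fin r → R} (hvK : v ∈ K) (hv : v ∈ Submodule.span k (termVector x '' (D : Set _))) :
    ∃ y ∈ Submodule.span k (termVector x '' {t | prependTerm σ t ∈ D}), freeModuleMap g y = v := by
  classical
  induction D using Finset.induction_on_max generalizing v with
  | empty =>
    have hv0 : v = 0 := by simpa using hv
    exact ⟨0, zero_mem _, by rw [hv0, map_zero]⟩
  | insert t D hmax ih =>
    have hDlen : ∀ s ∈ D, (ofLex s).2.length = j := fun s hs => hlen s (Finset.mem_insert_of_mem hs)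
    have htlen : (ofLex t).2.length = j := hlen t (Finset.mem_insert_self t D)
    have hDt : Submodule.span k (termVector x '' (D : Set _)) = lowerSpan k x t := by
      rw [lowerSpan]
      congr 2
      ext s
      refine ⟨fun hs => ⟨(hDlen s hs).trans htlen.symm, hmax s hs⟩, fun hs => ?_⟩
      exact Finset.mem_of_mem_insert_of_ne
        (hlower t (Finset.mem_insert_self t D) s (hs.1.trans htlen) hs.2) hs.2.ne
    have hDlower : ∀ u ∈ D, ∀ s, (ofLex s).2.length = j → s < u → s ∈ D := fun u hu s hs hsu =>
      Finset.mem_of_mem_insert_of_ne (hlower u (Finset.mem_insert_of_mem hu) s hs hsu)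
        (hsu.trans (hmax u hu)).ne
    have hmono : Submodule.span k (termVector x '' {t | prependTerm σ t ∈ D}) ≤
        Submodule.span k (termVector x '' {s | prependTerm σ s ∈ insert t D}) :=
      Submodule.span_mono (Set.image_mono fun s hs => Finset.mem_insert_of_mem hs)
    have hdone : ∀ v ∈ K, v ∈ lowerSpan k x t →
        ∃ y ∈ Submodule.span k (termVector x '' {s | prependTerm σ s ∈ insert t D}),
          freeModuleMap g y = v := fun v hvK hv => by
      obtain ⟨y, hy, hyv⟩ := ih hDlen hDlower hvK (hDt ▸ hv)
      exact ⟨y, hmono hy, hyv⟩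
    rw [Finset.coe_insert, Set.image_insert_eq, Submodule.mem_span_insert] at hv
    obtain ⟨a, z, hz, hvz⟩ := hv
    rw [hDt] at hz
    -- If `t` does not occur, or its word reduces, then `v` is a combination of smaller terms.
    by_cases ha : a = 0
    · exact hdone v hvK (by rw [hvz, ha, zero_smul, zero_add]; exact hz)
    by_cases hred : IsReducibleWord k x (ofLex t).2
    · refine hdone v hvK ?_
      rw [hvz]
      exact add_mem (Submodule.smul_mem _ _ ((termVector_mem_lowerSpan_iff t).2 hred)) hz
    -- Otherwise `t` is a leading term of `K`, and subtracting a multiple of an image cancels it.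
    · have ht : termVector x t ∈ K.restrictScalars k ⊔ lowerSpan k x t := by
        rw [← Submodule.smul_mem_iff _ ha, eq_sub_of_add_eq hvz.symm]
        exact sub_mem (Submodule.mem_sup_left hvK) (Submodule.mem_sup_right hz)
      obtain ⟨s, rfl⟩ := (hK t hred).1 ht
      obtain ⟨y, hy, hyv⟩ := hdone (v - freeModuleMap g (a • termVector x s))
        (sub_mem hvK (hg.freeModuleMap_mem _)) (by
          have := hg.freeModuleMap_termVector_sub_mem s
          have h2 : freeModuleMap g (a • termVector x s) = a • freeModuleMap g (termVector x s) :=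
            ((freeModuleMap g).restrictScalars k).map_smul a _
          rw [h2, hvz, show a • termVector x (prependTerm σ s) + z -
            a • freeModuleMap g (termVector x s) = z -
            a • (freeModuleMap g (termVector x s) - termVector x (prependTerm σ s)) by
              rw [smul_sub]; abel]
          exact sub_mem hz (Submodule.smul_mem _ _ this))
      refine ⟨y + a • termVector x s, add_mem hy (Submodule.smul_mem _ _
        (Submodule.subset_span ⟨s, Finset.mem_insert_self _ _, rfl⟩)), ?_⟩
      rw [map_add, hyv, sub_add_cancel]

/-- The images of the terms below `t` fill up the part of `K` below the leading term of the image
of `t`. -/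
theorem IsLeadingFamily.exists_mem_lowerSpan (hg : IsLeadingFamily k x K σ g)
    (hK : HasLeadingTerms k x K σ) {t : Fin r' ×ₗ List (Fin n)} {v : Fin r → R} (hvK : v ∈ K)
    (hv : v ∈ lowerSpan k x (prependTerm σ t)) :
    ∃ y ∈ lowerSpan k x t, freeModuleMap g y = v := by
  have hfin := finite_setOf_length_eq_and_lt (prependTerm σ t)
  obtain ⟨y, hy, hyv⟩ := hg.exists_freeModuleMap_eq_of_mem_span hK
    (ofLex (prependTerm σ t)).2.length hfin.toFinset (fun s hs => (hfin.mem_toFinset.1 hs).1) (by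
      simp only [Set.Finite.mem_toFinset, Set.mem_ofPred_eq]
      exact fun s hs u hu hus => ⟨hu, hus.trans hs.2⟩) hvK (by rw [hfin.coe_toFinset]; exact hv)
  refine ⟨y, Submodule.span_mono (Set.image_mono fun s hs => ?_) hy, hyv⟩
  simp only [Set.Finite.mem_toFinset, Set.mem_ofPred_eq, prependTerm_lt_prependTerm_iff,
    length_prependTerm, add_left_inj] at hs
  exact hs

theorem HasLeadingTerms.exists_isLeadingFamily (hx : LinearIndependent k x)
    (hK : HasLeadingTerms k x K σ) : ∃ g, IsLeadingFamily k x K σ g := by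
  have : ∀ s, ∃ v ∈ K, v - termVector x (prependTerm σ (toLex (s, []))) ∈
      lowerSpan k x (prependTerm σ (toLex (s, []))) := fun s => by
    obtain ⟨v, hv, z, hz, hvz⟩ := Submodule.mem_sup.1
      ((hK (prependTerm σ (toLex (s, []))) (not_isReducibleWord_singleton hx _)).2 ⟨_, rfl⟩)
    refine ⟨v, hv, ?_⟩
    rw [← hvz, sub_add_cancel_left]
    exact neg_mem hz
  choose g hgK hg using this
  exact ⟨g, hgK, hg⟩

/-- The pairs `(s, b')` such that `σ s = (c, b)` and `b b'` is a reducible word. -/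
noncomputable def nextLeadingPairs (k : Type*) {R : Type*} [Field k] [Ring R] [Algebra k R]
    {n r r' : ℕ} (x : Fin n → R) (σ : Fin r' ↪o Fin r ×ₗ Fin n) : Finset (Fin r' ×ₗ Fin n) :=
  open Classical in
  Finset.univ.filter fun p => IsReducibleWord k x [(ofLex (σ (ofLex p).1)).2, (ofLex p).2]

/-- The syzygies between the elements `g s` have the leading terms described by
`nextLeadingPairs`: a term is the leading term of a syzygy exactly if its image reduces to terms
below the expected leading term. -/
theorem IsLeadingFamily.hasLeadingTerms_ker (hg : IsLeadingFamily k x K σ g)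
    (hK : HasLeadingTerms k x K σ) (hx : LinearIndependent k x) (hPBW : IsPBW k x) :
    HasLeadingTerms k x (LinearMap.ker (freeModuleMap g))
      ((nextLeadingPairs k x σ).orderEmbOfFin rfl) := by
  classical
  intro t ht
  have hred : termVector x t ∈ (LinearMap.ker (freeModuleMap g)).restrictScalars k ⊔
      lowerSpan k x t ↔ IsReducibleWord k x (ofLex (prependTerm σ t)).2 := by
    rw [← termVector_mem_lowerSpan_iff]
    have hsub := hg.freeModuleMap_termVector_sub_mem t
    constructor
    · intro h
      obtain ⟨v, hv, z, hz, hvz⟩ := Submodule.mem_sup.1 h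
      have hv : freeModuleMap g v = 0 := hv
      rw [← hvz, map_add, hv, zero_add] at hsub
      have h := sub_mem (hg.freeModuleMap_mem_lowerSpan hz) hsub
      rwa [sub_sub_cancel] at h
    · intro h
      obtain ⟨y, hy, hyt⟩ := hg.exists_mem_lowerSpan hK (hg.freeModuleMap_mem (termVector x t))
        (by simpa using add_mem hsub h)
      rw [← sub_add_cancel (termVector x t) y]
      refine Submodule.add_mem_sup ?_ hy
      simp [hyt]
  rw [hred]
  obtain ⟨⟨s, w⟩, rfl⟩ := toLex.surjective t
  have hrange : ∀ p, p ∈ Set.range ((nextLeadingPairs k x σ).orderEmbOfFin rfl) ↔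
      IsReducibleWord k x [(ofLex (σ (ofLex p).1)).2, (ofLex p).2] := fun p => by
    rw [Finset.range_orderEmbOfFin]
    simp [nextLeadingPairs]
  simp only [prependTerm, ofLex_toLex] at ht ⊢
  cases w with
  | nil =>
    -- A syzygy has no leading term of degree zero, since letters are irreducible.
    refine ⟨fun h => absurd h (not_isReducibleWord_singleton hx _), ?_⟩
    rintro ⟨q, hq⟩
    simp [prependTerm] at hq
  | cons b w =>
    constructor
    · intro h
      obtain ⟨i, hi⟩ := (hrange (toLex (s, b))).2
        ((hPBW.isReducibleWord_cons_cons h).resolve_right ht)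
      exact ⟨toLex (i, w), by simp [prependTerm, hi]⟩
    · rintro ⟨q, hq⟩
      have h := (hrange _).1 ⟨(ofLex q).1, rfl⟩
      simp only [prependTerm, toLex_inj, Prod.mk.injEq, List.cons.injEq] at hq
      rw [hq.1, hq.2.1] at h
      exact h.append_append [] w

end LeadingTerms

/-! ### Homogeneous submodules -/

/-- A submodule of `R^r` is *homogeneous* if it contains the homogeneous components (with all
generators of `R^r` in degree `0`) of each of its elements. -/
def IsHomogeneousSubmodule {k R : Type*} [Field k] [Ring R] [Algebra k R]
    (𝒜 : ℕ → Submodule k R) [GradedAlgebra 𝒜] {r : ℕ} (K : Submodule Rᵐᵒᵖ (Fin r → R)) : Prop :=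
  ∀ v ∈ K, ∀ j, (fun c => GradedRing.proj 𝒜 j (v c)) ∈ K

section Homogeneous

variable {k R : Type*} [Field k] [Ring R] [Algebra k R] {𝒜 : ℕ → Submodule k R}
  [GradedAlgebra 𝒜] {n r r' : ℕ} {x : Fin n → R}

theorem GradedRing.proj_of_mem_self {j : ℕ} {a : R} (ha : a ∈ 𝒜 j) :
    GradedRing.proj 𝒜 j a = a := by
  rw [GradedRing.proj_apply, DirectSum.decompose_of_mem_same 𝒜 ha]

theorem GradedRing.proj_mem (j : ℕ) (a : R) : GradedRing.proj 𝒜 j a ∈ 𝒜 j := by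
  rw [GradedRing.proj_apply]
  exact SetLike.coe_mem _

theorem GradedRing.proj_succ_mul {a : R} (ha : a ∈ 𝒜 1) (b : R) (j : ℕ) :
    GradedRing.proj 𝒜 (j + 1) (a * b) = a * GradedRing.proj 𝒜 j b := by
  rw [GradedRing.proj_apply, GradedRing.proj_apply,
    DirectSum.coe_decompose_mul_of_left_mem _ _ ha, if_pos (by omega), Nat.add_sub_cancel]

theorem GradedRing.proj_zero_mul {a : R} (ha : a ∈ 𝒜 1) (b : R) :
    GradedRing.proj 𝒜 0 (a * b) = 0 := by
  rw [GradedRing.proj_apply, DirectSum.coe_decompose_mul_of_left_mem _ _ ha, if_neg (by omega)]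

theorem wordProd_mem (hx : ∀ i, x i ∈ 𝒜 1) (w : List (Fin n)) : wordProd x w ∈ 𝒜 w.length := by
  induction w with
  | nil => exact SetLike.GradedOne.one_mem
  | cons b w ih =>
    rw [wordProd_cons, List.length_cons, add_comm]
    exact SetLike.GradedMul.mul_mem (hx b) ih

omit [GradedAlgebra 𝒜] in
theorem IsMinimalLinearGenerators.mem (hx : IsMinimalLinearGenerators 𝒜 x) (i : Fin n) :
    x i ∈ 𝒜 1 :=
  hx.span_eq ▸ Submodule.subset_span (Set.mem_range_self i)

theorem IsStandardAlgebra.component_eq_span (hR : IsStandardAlgebra 𝒜)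
    (hx : IsMinimalLinearGenerators 𝒜 x) (j : ℕ) :
    𝒜 j = Submodule.span k (wordProd x '' {w | w.length = j}) := by
  classical
  apply le_antisymm
  · intro a ha
    have htop : a ∈ Submodule.span k (Set.range (wordProd x)) := by
      have h : a ∈ Subalgebra.toSubmodule (Algebra.adjoin k (Set.range x)) := by
        rw [← Algebra.adjoin_span, hx.span_eq, hR.generated]
        trivial
      rw [Algebra.adjoin_eq_span, ← FreeMonoid.mrange_lift,
        MonoidHom.coe_mrange, show ⇑(FreeMonoid.lift x) = fun w => wordProd x w.toList from
          funext fun w => FreeMonoid.lift_apply x w] at h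
      exact h
    rw [← GradedRing.proj_of_mem_self ha]
    clear ha
    induction htop using Submodule.span_induction with
    | mem b hb =>
      obtain ⟨w, rfl⟩ := hb
      by_cases hw : w.length = j
      · rw [GradedRing.proj_of_mem_self (hw ▸ wordProd_mem hx.mem w)]
        exact Submodule.subset_span ⟨w, hw, rfl⟩
      · rw [GradedRing.proj_apply, DirectSum.decompose_of_mem_ne 𝒜 (wordProd_mem hx.mem w) hw]
        exact zero_mem _
    | zero => rw [map_zero]; exact zero_mem _
    | add a b _ _ ha hb => rw [map_add]; exact add_mem ha hb
    | smul c a _ ha =>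
      have : GradedRing.proj 𝒜 j (c • a) = c • GradedRing.proj 𝒜 j a := by
        rw [GradedRing.proj_apply, GradedRing.proj_apply, DirectSum.decompose_smul]
        rfl
      rw [this]
      exact Submodule.smul_mem _ _ ha
  · rw [Submodule.span_le]
    rintro _ ⟨w, rfl, rfl⟩
    exact wordProd_mem hx.mem w

theorem exists_finset_sum_proj_eq (v : Fin r → R) :
    ∃ D : Finset ℕ, ∑ j ∈ D, (fun c => GradedRing.proj 𝒜 j (v c)) = v := by
  classical
  refine ⟨Finset.univ.biUnion fun c => (DirectSum.decompose 𝒜 (v c)).support, ?_⟩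
  ext c
  rw [Finset.sum_apply]
  simp only [GradedRing.proj_apply]
  conv_rhs => rw [← DirectSum.sum_support_decompose 𝒜 (v c)]
  refine (Finset.sum_subset (Finset.subset_biUnion_of_mem
    (fun c => (DirectSum.decompose 𝒜 (v c)).support) (Finset.mem_univ c)) ?_).symm
  intro j _ hj
  simpa using hj

omit [GradedAlgebra 𝒜] in
theorem mem_span_termVector (hA : ∀ j, 𝒜 j = Submodule.span k (wordProd x '' {w | w.length = j}))
    {v : Fin r → R} {j : ℕ} (hv : ∀ c, v c ∈ 𝒜 j) :
    v ∈ Submodule.span k (termVector x '' {t | (ofLex t).2.length = j}) := by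
  rw [← Finset.univ_sum_single v]
  refine sum_mem fun c _ => ?_
  have h := Submodule.mem_map_of_mem (f := LinearMap.single k (fun _ : Fin r => R) c)
    (hA j ▸ hv c)
  rw [Submodule.map_span] at h
  refine Submodule.span_mono ?_ h
  rintro _ ⟨_, ⟨w, hw, rfl⟩, rfl⟩
  exact ⟨toLex (c, w), hw, rfl⟩

theorem termVector_apply_mem (hx : ∀ i, x i ∈ 𝒜 1) (t : Fin r ×ₗ List (Fin n)) (c : Fin r) :
    termVector x t c ∈ 𝒜 (ofLex t).2.length := by
  rw [termVector]
  by_cases h : c = (ofLex t).1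
  · subst h
    rw [Pi.single_eq_same]
    exact wordProd_mem hx _
  · rw [Pi.single_eq_of_ne h]
    exact zero_mem _

theorem apply_mem_of_mem_lowerSpan (hx : ∀ i, x i ∈ 𝒜 1) {t : Fin r ×ₗ List (Fin n)}
    {v : Fin r → R} (hv : v ∈ lowerSpan k x t) (c : Fin r) : v c ∈ 𝒜 (ofLex t).2.length := by
  have h : lowerSpan k x t ≤ (𝒜 (ofLex t).2.length).comap (LinearMap.proj c) := by
    rw [lowerSpan, Submodule.span_le]
    rintro _ ⟨s, ⟨hlen, -⟩, rfl⟩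
    exact hlen ▸ termVector_apply_mem hx s c
  exact h hv

variable {K : Submodule Rᵐᵒᵖ (Fin r → R)} {σ : Fin r' ↪o Fin r ×ₗ Fin n} {g : Fin r' → Fin r → R}

theorem IsLeadingFamily.apply_mem (hg : IsLeadingFamily k x K σ g) (hx : ∀ i, x i ∈ 𝒜 1)
    (s : Fin r') (c : Fin r) : g s c ∈ 𝒜 1 := by
  have h := add_mem (apply_mem_of_mem_lowerSpan hx (hg.sub_mem_lowerSpan s) c)
    (termVector_apply_mem hx (prependTerm σ (toLex (s, []))) c)
  rwa [Pi.sub_apply, sub_add_cancel] at h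

theorem freeModuleMap_proj (hg : ∀ s c, g s c ∈ 𝒜 1) (v : Fin r' → R) (j : ℕ) :
    freeModuleMap g (fun s => GradedRing.proj 𝒜 j (v s)) =
      fun c => GradedRing.proj 𝒜 (j + 1) (freeModuleMap g v c) := by
  ext c
  simp only [freeModuleMap_apply, map_sum, GradedRing.proj_succ_mul (hg _ c)]

theorem freeModuleMap_mem_freeComponent (hg : ∀ s c, g s c ∈ 𝒜 1) {d j : ℕ} {v : Fin r' → R}
    (hv : v ∈ freeComponent 𝒜 r' (d + 1) j) : freeModuleMap g v ∈ freeComponent 𝒜 r d j := by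
  simp only [freeComponent, Submodule.mem_pi, Set.mem_univ, forall_const] at hv ⊢
  intro c
  rw [freeModuleMap_apply]
  refine sum_mem fun s _ => ?_
  have hvs := hv s
  unfold shiftedComponent at hvs ⊢
  split_ifs at hvs with h1
  · rw [if_pos (by omega), show j - d = 1 + (j - (d + 1)) by omega]
    exact SetLike.GradedMul.mul_mem (hg s c) hvs
  · rw [(Submodule.mem_bot k).1 hvs, mul_zero]
    exact zero_mem _

/-- A homogeneous submodule is generated by the elements chosen for its leading terms. -/
theorem IsLeadingFamily.range_freeModuleMap (hg : IsLeadingFamily k x K σ g)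
    (hK : HasLeadingTerms k x K σ) (hhom : IsHomogeneousSubmodule 𝒜 K)
    (hA : ∀ j, 𝒜 j = Submodule.span k (wordProd x '' {w | w.length = j})) :
    LinearMap.range (freeModuleMap g) = K := by
  apply le_antisymm
  · rintro _ ⟨v, rfl⟩
    exact hg.freeModuleMap_mem v
  · intro v hv
    obtain ⟨D, hD⟩ := exists_finset_sum_proj_eq (𝒜 := 𝒜) v
    rw [← hD]
    refine sum_mem fun j _ => ?_
    have hfin : {t : Fin r ×ₗ List (Fin n) | (ofLex t).2.length = j}.Finite := by
      refine Set.Finite.subset (((Set.finite_univ (α := Fin r)).prod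
        (List.finite_length_eq (Fin n) j)).preimage ofLex.injective.injOn) fun t ht => ?_
      simpa using ht
    obtain ⟨y, -, hy⟩ := hg.exists_freeModuleMap_eq_of_mem_span hK j hfin.toFinset
      (fun t ht => hfin.mem_toFinset.1 ht) (fun t _ s hs _ => hfin.mem_toFinset.2 hs)
      (hhom v hv j) (by
        rw [hfin.coe_toFinset]
        exact mem_span_termVector hA fun c => GradedRing.proj_mem j (v c))
    exact ⟨y, hy⟩

theorem isHomogeneousSubmodule_ker_freeModuleMap (hg : ∀ s c, g s c ∈ 𝒜 1) :
    IsHomogeneousSubmodule 𝒜 (LinearMap.ker (freeModuleMap g)) := by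
  intro v hv j
  rw [LinearMap.mem_ker] at hv ⊢
  rw [freeModuleMap_proj hg, hv]
  ext c
  simp

end Homogeneous

/-! ### Linear resolutions of submodules with known leading terms -/

/-- A homogeneous submodule `K` of a free module `R^r` with `r'` generators, whose leading terms
are encoded by `σ`. The stages of the resolution are of this kind. -/
structure SyzygyStage {k R : Type*} [Field k] [Ring R] [Algebra k R]
    (𝒜 : ℕ → Submodule k R) [GradedAlgebra 𝒜] {n : ℕ} (x : Fin n → R) where
  r : ℕ
  r' : ℕ
  σ : Fin r' ↪o Fin r ×ₗ Fin n
  K : Submodule Rᵐᵒᵖ (Fin r → R)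
  hasLeadingTerms : HasLeadingTerms k x K σ
  isHomogeneousSubmodule : IsHomogeneousSubmodule 𝒜 K

namespace SyzygyStage

variable {k R : Type*} [Field k] [Ring R] [Algebra k R] {𝒜 : ℕ → Submodule k R}
  [GradedAlgebra 𝒜] {n : ℕ} {x : Fin n → R} (hx : IsMinimalLinearGenerators 𝒜 x)
  (hPBW : IsPBW k x)

include hx in
theorem exists_isLeadingFamily (s : SyzygyStage 𝒜 x) : ∃ g, IsLeadingFamily k x s.K s.σ g :=
  s.hasLeadingTerms.exists_isLeadingFamily hx.linearIndependent

/-- Generators of the submodule. -/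
noncomputable def gens (s : SyzygyStage 𝒜 x) : Fin s.r' → Fin s.r → R :=
  (s.exists_isLeadingFamily hx).choose

theorem isLeadingFamily_gens (s : SyzygyStage 𝒜 x) : IsLeadingFamily k x s.K s.σ (s.gens hx) :=
  (s.exists_isLeadingFamily hx).choose_spec

/-- The module of relations between the chosen generators. -/
noncomputable def next (s : SyzygyStage 𝒜 x) : SyzygyStage 𝒜 x where
  r := s.r'
  r' := (nextLeadingPairs k x s.σ).card
  σ := (nextLeadingPairs k x s.σ).orderEmbOfFin rfl
  K := LinearMap.ker (freeModuleMap (s.gens hx))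
  hasLeadingTerms := (s.isLeadingFamily_gens hx).hasLeadingTerms_ker s.hasLeadingTerms
    hx.linearIndependent hPBW
  isHomogeneousSubmodule := isHomogeneousSubmodule_ker_freeModuleMap
    ((s.isLeadingFamily_gens hx).apply_mem hx.mem)

/-- The iterated syzygies. -/
noncomputable def iter (s : SyzygyStage 𝒜 x) : ℕ → SyzygyStage 𝒜 x
  | 0 => s
  | i + 1 => (s.iter i).next hx hPBW

/-- The differentials of the resolution, the one numbered `0` being the cover of the submodule
that is resolved. -/
noncomputable def map (s : SyzygyStage 𝒜 x) (i : ℕ) :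
    (Fin (s.iter hx hPBW i).r' → R) →ₗ[Rᵐᵒᵖ] (Fin (s.iter hx hPBW i).r → R) :=
  freeModuleMap ((s.iter hx hPBW i).gens hx)

theorem map_mem_freeComponent (s : SyzygyStage 𝒜 x) (i : ℕ) {d j : ℕ}
    {v : Fin (s.iter hx hPBW i).r' → R}
    (hv : v ∈ freeComponent 𝒜 (s.iter hx hPBW i).r' (d + 1) j) :
    s.map hx hPBW i v ∈ freeComponent 𝒜 (s.iter hx hPBW i).r d j :=
  freeModuleMap_mem_freeComponent
    (((s.iter hx hPBW i).isLeadingFamily_gens hx).apply_mem hx.mem) hv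

theorem range_map (hR : IsStandardAlgebra 𝒜) (s : SyzygyStage 𝒜 x) (i : ℕ) :
    LinearMap.range (s.map hx hPBW i) = (s.iter hx hPBW i).K :=
  ((s.iter hx hPBW i).isLeadingFamily_gens hx).range_freeModuleMap
    (s.iter hx hPBW i).hasLeadingTerms (s.iter hx hPBW i).isHomogeneousSubmodule
    (hR.component_eq_span hx)

theorem exact_map (hR : IsStandardAlgebra 𝒜) (s : SyzygyStage 𝒜 x) (i : ℕ) :
    Function.Exact (s.map hx hPBW (i + 1)) (s.map hx hPBW i) :=
  LinearMap.exact_iff.2 (s.range_map hx hPBW hR (i + 1)).symm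

/-- The linear free resolution, by iterated syzygies, of a graded module isomorphic to the
submodule of a stage. All generators of the module have degree `1`. -/
noncomputable def resolution (hR : IsStandardAlgebra 𝒜) (s : SyzygyStage 𝒜 x) {M : Type*}
    [AddCommGroup M] [Module k M] [Module Rᵐᵒᵖ M] [IsScalarTower k Rᵐᵒᵖ M]
    {ℳ : ℕ → Submodule k M} (e : s.K ≃ₗ[Rᵐᵒᵖ] M)
    (he : ∀ j (v : s.K), (∀ c, (v : Fin s.r → R) c ∈ 𝒜 j) → e v ∈ ℳ j) :
    LinearFreeResolution 𝒜 ℳ 1 :=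
  have hrange : ∀ v, v ∈ LinearMap.range (s.map hx hPBW 0) ↔ v ∈ s.K :=
    fun v => by rw [s.range_map hx hPBW hR 0]; rfl
  { rank := fun i => (s.iter hx hPBW i).r'
    aug := e.toLinearMap.comp
      ((s.map hx hPBW 0).codRestrict s.K fun v => (hrange _).1 ⟨v, rfl⟩)
    diff := fun i => s.map hx hPBW (i + 1)
    aug_graded := fun j v hv => by
      have h := s.map_mem_freeComponent hx hPBW 0 (d := 0) hv
      simp only [freeComponent, Submodule.mem_pi, Set.mem_univ, forall_const, shiftedComponent,
        Nat.zero_le, if_true, Nat.sub_zero] at h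
      exact he j _ h
    diff_graded := fun i j v hv => s.map_mem_freeComponent hx hPBW (i + 1) hv
    aug_surjective := e.surjective.comp fun a => by
      obtain ⟨v, hv⟩ := (hrange a.1).2 a.2
      exact ⟨v, Subtype.ext hv⟩
    exact_zero := fun v => by
      refine Iff.trans ?_ (s.exact_map hx hPBW hR 0 v)
      exact (LinearEquiv.map_eq_zero_iff e).trans Subtype.ext_iff
    exact_succ := fun i => s.exact_map hx hPBW hR (i + 1) }

end SyzygyStage

/-! ### The ideals of the flag -/

section Flag

variable {k R : Type*} [Field k] [Ring R] [Algebra k R] {𝒜 : ℕ → Submodule k R}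
  [GradedAlgebra 𝒜] {n : ℕ} {x : Fin n → R}

theorem mul_mem_flagIdeal {m : ℕ} {b : Fin n} (hb : (b : ℕ) < m) (a : R) :
    x b * a ∈ flagIdeal x m :=
  (flagIdeal x m).smul_mem (MulOpposite.op a) (Submodule.subset_span ⟨b, hb, rfl⟩)

theorem proj_zero_of_mem_flagIdeal (hx : ∀ i, x i ∈ 𝒜 1) {m : ℕ} {a : R}
    (ha : a ∈ flagIdeal x m) : GradedRing.proj 𝒜 0 a = 0 := by
  rw [flagIdeal] at ha
  induction ha using Submodule.closure_induction with
  | zero => exact map_zero _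
  | add a b _ _ ha hb => rw [map_add, ha, hb, add_zero]
  | smul_mem c a ha =>
    obtain ⟨b, -, rfl⟩ := ha
    exact GradedRing.proj_zero_mul (hx b) c.unop

/-- The components of positive degree of an element of `x_1 R + ⋯ + x_m R` are linear combinations
of words that start with one of the first `m` letters. -/
theorem proj_succ_mem_span_of_mem_flagIdeal (hx : ∀ i, x i ∈ 𝒜 1)
    (hA : ∀ j, 𝒜 j = Submodule.span k (wordProd x '' {w | w.length = j})) {m : ℕ} {a : R}
    (ha : a ∈ flagIdeal x m) (j : ℕ) :
    GradedRing.proj 𝒜 (j + 1) a ∈ Submodule.span k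
      (wordProd x '' {w | ∃ b u, w = b :: u ∧ (b : ℕ) < m ∧ u.length = j}) := by
  rw [flagIdeal] at ha
  induction ha using Submodule.closure_induction with
  | zero => rw [map_zero]; exact zero_mem _
  | add a b _ _ ha hb => rw [map_add]; exact add_mem ha hb
  | smul_mem c a ha =>
    obtain ⟨b, hb, rfl⟩ := ha
    have h1 : c • x b = x b * c.unop := rfl
    rw [h1, GradedRing.proj_succ_mul (hx b)]
    have h := Submodule.mem_map_of_mem (f := LinearMap.mulLeft k (x b))
      ((hA j).le (GradedRing.proj_mem j c.unop))
    rw [Submodule.map_span] at h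
    refine Submodule.span_mono ?_ h
    rintro _ ⟨_, ⟨u, hu, rfl⟩, rfl⟩
    exact ⟨b :: u, ⟨b, u, rfl, hb, hu⟩, by simp⟩

theorem wordProd_span_le_flagIdeal (m j : ℕ) :
    Submodule.span k (wordProd x '' {w | ∃ b u, w = b :: u ∧ (b : ℕ) < m ∧ u.length = j}) ≤
      (flagIdeal x m).restrictScalars k := by
  rw [Submodule.span_le]
  rintro _ ⟨_, ⟨b, u, rfl, hb, -⟩, rfl⟩
  rw [wordProd_cons]
  exact mul_mem_flagIdeal hb _

theorem proj_mem_flagIdeal (hR : IsStandardAlgebra 𝒜) (hx : IsMinimalLinearGenerators 𝒜 x) {m : ℕ}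
    {a : R} (ha : a ∈ flagIdeal x m) (j : ℕ) : GradedRing.proj 𝒜 j a ∈ flagIdeal x m := by
  cases j with
  | zero =>
    rw [proj_zero_of_mem_flagIdeal hx.mem ha]
    exact zero_mem _
  | succ j =>
    exact wordProd_span_le_flagIdeal m j
      (proj_succ_mem_span_of_mem_flagIdeal hx.mem (hR.component_eq_span hx) ha j)

theorem isGradedRightModule_flagIdeal (hR : IsStandardAlgebra 𝒜)
    (hx : IsMinimalLinearGenerators 𝒜 x) (m : ℕ) :
    IsGradedRightModule 𝒜 (rightIdealComponent 𝒜 (flagIdeal x m)) where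
  internal := by
    classical
    rw [DirectSum.isInternal_submodule_iff_iSupIndep_and_iSup_eq_top]
    constructor
    · intro i
      rw [Submodule.disjoint_def]
      intro v hv hv'
      have h1 := Submodule.mem_map_of_mem (f := (flagIdeal x m).subtype.restrictScalars k) hv'
      simp only [Submodule.map_iSup] at h1
      refine Subtype.ext (Submodule.disjoint_def.1
        ((DirectSum.Decomposition.isInternal 𝒜).submodule_iSupIndep i) _ hv ?_)
      exact iSup₂_mono (fun j _ => Submodule.map_comap_le _ _) h1
    · rw [eq_top_iff]
      intro v _
      have hv : v = ∑ j ∈ (DirectSum.decompose 𝒜 (v : R)).support,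
          (⟨GradedRing.proj 𝒜 j v, proj_mem_flagIdeal hR hx v.2 j⟩ : flagIdeal x m) := by
        apply Subtype.ext
        rw [AddSubmonoidClass.coe_finsetSum]
        exact (DirectSum.sum_support_decompose 𝒜 (v : R)).symm
      rw [hv]
      exact sum_mem fun j _ => Submodule.mem_iSup_of_mem j (GradedRing.proj_mem j (v : R))
  smul_mem i j v hv a ha := SetLike.GradedMul.mul_mem (A := 𝒜) (gi := (v : R)) (gj := a) hv ha
  finite_component j := by
    have := hR.finite_component j
    exact FiniteDimensional.of_injective
      (((flagIdeal x m).subtype.restrictScalars k).restrict (q := 𝒜 j) fun v hv => hv)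
      fun v w h => Subtype.ext (Subtype.ext (congrArg (fun a : 𝒜 j => (a : R)) h))

/-- The pairs that encode the leading terms of `x_1 R + ⋯ + x_m R` as a submodule of `R^1`. -/
def flagEmbedding {m : ℕ} (hm : m ≤ n) : Fin m ↪o Fin 1 ×ₗ Fin n :=
  OrderEmbedding.ofStrictMono (fun s => toLex (0, Fin.castLE hm s)) fun _ _ h =>
    Prod.Lex.lt_iff.2 (Or.inr ⟨rfl, h⟩)

theorem mem_range_prependTerm_flagEmbedding {m : ℕ} (hm : m ≤ n) (w : List (Fin n)) :
    toLex ((0 : Fin 1), w) ∈ Set.range (prependTerm (flagEmbedding hm)) ↔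
      ∃ b u, w = b :: u ∧ (b : ℕ) < m := by
  constructor
  · rintro ⟨t, ht⟩
    simp only [prependTerm, toLex_inj, Prod.mk.injEq] at ht
    exact ⟨_, _, ht.2.symm, (ofLex t).1.2⟩
  · rintro ⟨b, u, rfl, hb⟩
    exact ⟨toLex (⟨b, hb⟩, u), rfl⟩

/-- Reducing a word never increases its first letter; so the leading terms of
`x_1 R + ⋯ + x_m R` are the normal words that start with one of the first `m` letters. -/
theorem hasLeadingTerms_flagIdeal (hR : IsStandardAlgebra 𝒜)
    (hx : IsMinimalLinearGenerators 𝒜 x) {m : ℕ} (hm : m ≤ n) :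
    HasLeadingTerms k x ((flagIdeal x m).comap (LinearMap.proj (0 : Fin 1)))
      (flagEmbedding hm) := by
  intro t ht
  obtain ⟨⟨c, w⟩, rfl⟩ := toLex.surjective t
  -- All terms of `R^1` have the same index.
  obtain rfl : c = 0 := Subsingleton.elim _ _
  rw [mem_range_prependTerm_flagEmbedding]
  simp only [ofLex_toLex] at ht
  constructor
  · intro h
    obtain ⟨v, hv, z, hz, hvz⟩ := Submodule.mem_sup.1 h
    have hv : v 0 ∈ flagIdeal x m := hv
    have hz0 := apply_mem_of_mem_lowerSpan hx.mem hz 0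
    have hv0 : v 0 ∈ 𝒜 w.length := by
      rw [eq_sub_of_add_eq hvz]
      exact sub_mem (termVector_apply_mem hx.mem (toLex ((0 : Fin 1), w)) 0) hz0
    cases w with
    | nil =>
      refine absurd ?_ ht
      -- The ideal has no component of degree zero.
      have h0 := proj_zero_of_mem_flagIdeal hx.mem hv
      have h0 : v 0 = 0 := (GradedRing.proj_of_mem_self hv0).symm.trans h0
      have hv' : v = 0 := by
        ext c
        rw [Subsingleton.elim c 0, h0, Pi.zero_apply]
      rw [hv', zero_add] at hvz
      rw [hvz] at hz
      exact (termVector_mem_lowerSpan_iff (toLex ((0 : Fin 1), []))).1 hz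
    | cons b w =>
      -- If the first letter were not among the first `m`, all words in the component of the ideal
      -- would be smaller than `b w`, so that `b w` would be reducible.
      refine ⟨b, w, rfl, ?_⟩
      by_contra hb
      apply ht
      have hspan := proj_succ_mem_span_of_mem_flagIdeal hx.mem (hR.component_eq_span hx) hv w.length
      rw [show GradedRing.proj 𝒜 (w.length + 1) (v 0) = v 0 from
        GradedRing.proj_of_mem_self hv0] at hspan
      refine (termVector_mem_lowerSpan_iff (toLex ((0 : Fin 1), b :: w))).1 ?_
      rw [← hvz]
      refine add_mem ?_ hz
      have h1 := Submodule.mem_map_of_mem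
        (f := LinearMap.single k (fun _ : Fin 1 => R) 0) hspan
      have h2 : LinearMap.single k (fun _ : Fin 1 => R) 0 (v 0) = v := by
        ext c
        rw [Subsingleton.elim c 0]
        simp
      rw [h2, Submodule.map_span] at h1
      refine Submodule.span_mono ?_ h1
      rintro _ ⟨_, ⟨_, ⟨a, u, rfl, ha, hu⟩, rfl⟩, rfl⟩
      refine ⟨toLex (0, a :: u), ⟨by simp [hu], ?_⟩, rfl⟩
      refine Prod.Lex.lt_iff.2 (Or.inr ⟨rfl, List.cons_lt_cons_iff.2 (Or.inl ?_)⟩)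
      rw [Fin.lt_def]
      omega
  · rintro ⟨b, u, rfl, hb⟩
    refine Submodule.mem_sup_left ?_
    change wordProd x (b :: u) ∈ flagIdeal x m
    rw [wordProd_cons]
    exact mul_mem_flagIdeal hb _

/-- The ideal `x_1 R + ⋯ + x_m R` as a submodule of `R^1`. -/
noncomputable def flagStage (hR : IsStandardAlgebra 𝒜) (hx : IsMinimalLinearGenerators 𝒜 x) {m : ℕ}
    (hm : m ≤ n) : SyzygyStage 𝒜 x where
  r := 1
  r' := m
  σ := flagEmbedding hm
  K := (flagIdeal x m).comap (LinearMap.proj (0 : Fin 1))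
  hasLeadingTerms := hasLeadingTerms_flagIdeal hR hx hm
  isHomogeneousSubmodule v hv j := proj_mem_flagIdeal hR hx (a := v 0) hv j

/-- The identification of the submodule of `R^1` with the ideal. -/
def flagIdealEquiv (x : Fin n → R) (m : ℕ) :
    (flagIdeal x m).comap (LinearMap.proj (0 : Fin 1) : (Fin 1 → R) →ₗ[Rᵐᵒᵖ] R) ≃ₗ[Rᵐᵒᵖ]
      flagIdeal x m where
  toFun v := ⟨v.1 0, v.2⟩
  invFun a := ⟨fun _ => a, a.2⟩
  map_add' _ _ := rfl
  map_smul' _ _ := rfl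
  left_inv v := Subtype.ext (funext fun c => by rw [Subsingleton.elim c 0])
  right_inv _ := rfl

theorem isLinearFlag (hR : IsStandardAlgebra 𝒜) (hx : IsMinimalLinearGenerators 𝒜 x) :
    IsLinearFlag 𝒜 x where
  linear := hx.mem
  top_eq := by
    ext a
    rw [SetLike.mem_coe, SetLike.mem_coe, HomogeneousIdeal.mem_irrelevant_iff]
    refine ⟨proj_zero_of_mem_flagIdeal hx.mem, fun ha => ?_⟩
    classical
    rw [← DirectSum.sum_support_decompose 𝒜 a]
    refine sum_mem fun j _ => ?_
    rw [← GradedRing.proj_apply]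
    cases j with
    | zero => rw [ha]; exact zero_mem _
    | succ j =>
      have h := (hR.component_eq_span hx (j + 1)).le (GradedRing.proj_mem (j + 1) a)
      refine wordProd_span_le_flagIdeal n j (Submodule.span_mono (Set.image_mono ?_) h)
      rintro (_ | ⟨b, u⟩) hw
      · exact absurd hw (by simp)
      · exact ⟨b, u, rfl, b.2, by simpa using hw⟩

end Flag

/-- If `R` is PBW with respect to the order `x_1 < ⋯ < x_n` on its minimal linear generators, then
`(x_1, …, x_n)` is a Koszul flag. -/
theorem mainTheorem4 {k R : Type*} [Field k] [Ring R] [Algebra k R]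
    (𝒜 : ℕ → Submodule k R) [GradedAlgebra 𝒜] (hR : IsStandardAlgebra 𝒜)
    {n : ℕ} (x : Fin n → R) (hx : IsMinimalLinearGenerators 𝒜 x) (hPBW : IsPBW k x) :
    IsKoszulFlag 𝒜 x where
  isLinearFlag := isLinearFlag hR hx
  koszul m _ hm := ⟨isGradedRightModule_flagIdeal hR hx m, 1,
    ⟨(flagStage hR hx hm).resolution hx hPBW hR (flagIdealEquiv x m) fun _ _ hv =>
      hv (0 : Fin 1)⟩⟩
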